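/- Let $\sigma$ be a positive measure on $[0,2\pi]$ with $\frac1{2\pi}\int_0^{2\pi}d\sigma=1$ that is not concentrated on finitely many points. Let $\Phi_k$ be the monic polynomial of degree $k$ with $\int_0^{2\pi}e^{-ij\varphi}\Phi_k(e^{i\varphi})\,d\sigma(\varphi)=0$ for $j=0,\dots,k-1$. For a polynomial $P$ of degree $k$ put $P^*(z)=z^k\overline{P}(1/z)$, where $\overline P$ has the complex conjugate coefficients. Let $\mathbb T=\{|z|=1\}$ and $\mathbb D=\{|z|<1\}$. For $\varphi_1,\dots,\varphi_n$ with $0\le\varphi_1<\dots<\varphi_n<2\pi$ we say that $T_n(z)=\prod_{s=1}^n(z-e^{i\varphi_s})$ generates a positive $(d,n,d\sigma)$ quadrature formula if there are $\mu_1,\dots,\mu_n>0$ such that $\frac1{2\pi}\int_0^{2\pi}t\,d\sigma=\sum_{s=1}^n\mu_s t(\varphi_s)$ for all real trigonometric polynomials $t$ of degree at most $d$. Let $0\le l\le n-1$, let $\kappa\in\mathbb T$, and let $P=z\Phi_{n-1-l}+\kappa\Phi_{n-1-l}^*$. Then the following hold. (1) There are $0\le\psi_1<\dots<\psi_{n-l}<2\pi$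 such that $P(z)=\prod_{\nu=1}^{n-l}(z-e^{i\psi_\nu})$. (2) Let $0\le m\le l$ and suppose that $T_n$ generates a positive $(n-1-m,n,d\sigma)$ quadrature formula. (a) If $T_n\ne P$ (which is automatic for $l\ge1$), then every open arc of the unit circle between two consecutive zeros of $P$ contains at least one node $e^{i\varphi_s}$. (The arc from the last zero to the first is included; if $P$ has only one zero, the arc is the circle without that zero.) (b) There are $\eta\in\mathbb T$ and a monic polynomial $q_l$ of degree $l$ with all zeros in $\mathbb D$ such that $T_n=zq_l\Phi_{n-1-l}+\eta q_l^*\Phi_{n-1-l}^*$. For every such representation, each common zero of $T_n$ and $P$ is a zero of $\kappa q_l-\eta q_l^*$. (3) In particular, let $\eta\in\mathbb T$ and suppose that $z\Phi_{n-1}+\eta\Phi_{n-1}^*\neq P$. Then every open arc between two consecutive zeros of $P$ contains at least one zero of $z\Phi_{n-1}+\eta\Phi_{n-1}^*$. -/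

import Mathlib

open MeasureTheory Set Polynomial

noncomputable section

/-- The point `e^{iθ}` of the unit circle. -/
def cis (θ : ℝ) : ℂ := Complex.exp (θ * Complex.I)

/-- `σ` is a positive measure on `[0, 2π]` with `(1/2π) ∫ dσ = 1`, not concentrated on finitely many
points, so that the monic orthogonal polynomials of every degree exist and are unique. -/
structure IsSzegoMeasure (σ : Measure ℝ) : Prop where
  concentrated : σ (Icc 0 (2 * Real.pi))ᶜ = 0
  mass : σ (Icc 0 (2 * Real.pi)) = ENNReal.ofReal (2 * Real.pi)
  nontrivial : ∀ S : Set ℝ, S.Finite → σ Sᶜ ≠ 0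

/-- `P(z) = z^k + …` is monic of degree `k` and
`∫ e^{-ijθ} P(e^{iθ}) dσ(θ) = 0` for `j = 0, …, k - 1`. -/
def IsMonicOrthogonal (σ : Measure ℝ) (k : ℕ) (P : ℂ[X]) : Prop :=
  P.Monic ∧ P.natDegree = k ∧ ∀ j < k, ∫ θ, cis (-(j * θ)) * P.eval (cis θ) ∂σ = 0

theorem norm_cis (θ : ℝ) : ‖cis θ‖ = 1 := Complex.norm_exp_ofReal_mul_I θ

theorem continuous_cis : Continuous cis := by unfold cis; fun_prop

theorem injOn_cis : InjOn cis (Ico 0 (2 * Real.pi)) := by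
  intro x hx y hy h
  obtain ⟨k, hk⟩ := Complex.exp_eq_exp_iff_exists_int.1 h
  have h2 : x = y + k * (2 * Real.pi) := by
    have := congrArg Complex.im hk
    simpa using this
  have hp := Real.pi_pos
  have h3 : (k : ℝ) < 1 := by
    by_contra! hc
    nlinarith [hx.2, hy.1]
  have h4 : (-1 : ℝ) < k := by
    by_contra! hc
    nlinarith [hx.1, hy.2]
  have h5 : k = 0 := by
    have a : k < 1 := by exact_mod_cast h3
    have b : -1 < k := by exact_mod_cast h4
    omega
  simpa [h5] using h2

theorem finite_zero_angles {p : ℂ[X]} (hp : p ≠ 0) :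
    {θ ∈ Icc 0 (2 * Real.pi) | p.IsRoot (cis θ)}.Finite := by
  have h1 : (Ico 0 (2 * Real.pi) ∩ cis ⁻¹' {z | p.IsRoot z}).Finite := by
    refine Set.Finite.of_finite_image (f := cis) ?_ (injOn_cis.mono inter_subset_left)
    refine (p.finite_setOfPred_isRoot hp).subset ?_
    rintro _ ⟨θ, hθ, rfl⟩
    exact hθ.2
  refine (h1.union (finite_singleton (2 * Real.pi))).subset ?_
  rintro θ ⟨h, hr⟩
  rcases h.2.lt_or_eq with h' | h'
  · exact Or.inl ⟨⟨h.1, h'⟩, hr⟩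
  · exact Or.inr h'

theorem IsSzegoMeasure.isFiniteMeasure {σ : Measure ℝ} (hσ : IsSzegoMeasure σ) :
    IsFiniteMeasure σ := by
  constructor
  rw [← measure_add_measure_compl (measurableSet_Icc (a := (0 : ℝ)) (b := 2 * Real.pi)),
    hσ.concentrated, hσ.mass, add_zero]
  exact ENNReal.ofReal_lt_top

theorem integrable_cis_mul_eval {σ : Measure ℝ} (hσ : IsSzegoMeasure σ) (a : ℝ) (p : ℂ[X]) :
    Integrable (fun θ => cis (-(a * θ)) * p.eval (cis θ)) σ := by
  have := hσ.isFiniteMeasure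
  have hc : Continuous fun θ : ℝ => cis (-(a * θ)) * p.eval (cis θ) :=
    (continuous_cis.comp (by fun_prop)).mul (p.continuous.comp continuous_cis)
  refine Integrable.of_bound hc.aestronglyMeasurable (∑ i ∈ p.support, ‖p.coeff i‖) ?_
  refine Filter.Eventually.of_forall fun θ => ?_
  rw [norm_mul, norm_cis, one_mul, Polynomial.eval_eq_sum, Polynomial.sum]
  refine (norm_sum_le _ _).trans (le_of_eq ?_)
  simp [norm_cis]

theorem eq_zero_of_orthogonal {σ : Measure ℝ} (hσ : IsSzegoMeasure σ) {k : ℕ} {p : ℂ[X]}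
    (hp : p ∈ degreeLT ℂ k)
    (h : ∀ j < k, ∫ θ, cis (-(j * θ)) * p.eval (cis θ) ∂σ = 0) : p = 0 := by
  by_contra hne
  have hfin := hσ.isFiniteMeasure
  have hconj : ∀ (j : ℕ) (θ : ℝ), (starRingEnd ℂ) (cis θ) ^ j = cis (-(j * θ)) := by
    intro j θ
    simp only [cis]
    rw [← Complex.exp_conj, ← Complex.exp_nat_mul]
    congr 1
    simp
    ring
  have hexp : ∀ θ : ℝ, ((‖p.eval (cis θ)‖ ^ 2 : ℝ) : ℂ) =
      ∑ j ∈ p.support, (starRingEnd ℂ) (p.coeff j) * (cis (-(j * θ)) * p.eval (cis θ)) := by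
    intro θ
    push_cast
    rw [← Complex.conj_mul']
    nth_rewrite 1 [Polynomial.eval_eq_sum]
    rw [Polynomial.sum, map_sum, Finset.sum_mul]
    refine Finset.sum_congr rfl fun j _ => ?_
    rw [map_mul, map_pow, hconj, mul_assoc]
  have hint : ∀ j : ℕ, Integrable (fun θ : ℝ =>
      (starRingEnd ℂ) (p.coeff j) * (cis (-(j * θ)) * p.eval (cis θ))) σ :=
    fun j => (integrable_cis_mul_eval hσ j p).const_mul _
  have h0 : ∫ θ, ((‖p.eval (cis θ)‖ ^ 2 : ℝ) : ℂ) ∂σ = 0 := by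
    simp_rw [hexp]
    rw [integral_finsetSum _ fun j _ => hint j]
    refine Finset.sum_eq_zero fun j hj => ?_
    rw [integral_const_mul, h j ?_, mul_zero]
    have := (mem_degreeLT.1 hp)
    have h2 := le_degree_of_mem_supp j hj
    exact_mod_cast h2.trans_lt this
  have hI : Integrable (fun θ => ‖p.eval (cis θ)‖ ^ 2) σ := by
    have := (integrable_finsetSum p.support fun j _ => hint j)
    simp_rw [← hexp] at this
    exact this.re.congr (Filter.Eventually.of_forall fun θ => Complex.ofReal_re _)
  rw [integral_complex_ofReal, Complex.ofReal_eq_zero,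
    integral_eq_zero_iff_of_nonneg (fun θ => by positivity) hI] at h0
  refine hσ.nontrivial _ (finite_zero_angles hne) ?_
  have hA : ∀ᵐ θ ∂σ, θ ∈ Icc 0 (2 * Real.pi) := hσ.concentrated
  have hB : ∀ᵐ θ ∂σ, θ ∈ {θ ∈ Icc 0 (2 * Real.pi) | p.IsRoot (cis θ)} := by
    filter_upwards [hA, h0] with θ h1 h2
    exact ⟨h1, by simpa using h2⟩
  exact hB

theorem existsUnique_isMonicOrthogonal {σ : Measure ℝ} (hσ : IsSzegoMeasure σ) (k : ℕ) :
    ∃! P, IsMonicOrthogonal σ k P := by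
  let L : degreeLT ℂ k →ₗ[ℂ] (Fin k → ℂ) :=
    { toFun := fun p j => ∫ θ, cis (-((j : ℕ) * θ)) * (p : ℂ[X]).eval (cis θ) ∂σ
      map_add' := by
        intro p q
        ext j
        simp only [Submodule.coe_add, eval_add, mul_add, Pi.add_apply]
        exact integral_add (integrable_cis_mul_eval hσ _ _) (integrable_cis_mul_eval hσ _ _)
      map_smul' := by
        intro c p
        ext j
        simp only [Submodule.coe_smul, eval_smul, smul_eq_mul, RingHom.id_apply, Pi.smul_apply]
        rw [← integral_const_mul]
        exact integral_congr_ae (Filter.Eventually.of_forall fun θ => by ring) }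
  have hinj : Function.Injective L := by
    rw [← LinearMap.ker_eq_bot, LinearMap.ker_eq_bot']
    intro p hp
    exact Subtype.ext (eq_zero_of_orthogonal hσ p.2 fun j hj => congrFun hp ⟨j, hj⟩)
  have : FiniteDimensional ℂ (degreeLT ℂ k) :=
    Module.Finite.equiv (degreeLTEquiv ℂ k).symm
  have hsurj : Function.Surjective L :=
    (LinearMap.injective_iff_surjective_of_finrank_eq_finrank
      (degreeLTEquiv ℂ k).finrank_eq).1 hinj
  obtain ⟨p, hp⟩ := hsurj fun j =>
    -∫ θ, cis (-((j : ℕ) * θ)) * (X ^ k : ℂ[X]).eval (cis θ) ∂σ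
  have hpk := mem_degreeLT.1 p.2
  have ho : ∀ j < k, ∫ θ, cis (-(j * θ)) * (X ^ k + (p : ℂ[X])).eval (cis θ) ∂σ = 0 := by
    intro j hj
    have h1 := congrFun hp ⟨j, hj⟩
    simp only [eval_add, mul_add]
    rw [integral_add (integrable_cis_mul_eval hσ _ _) (integrable_cis_mul_eval hσ _ _)]
    exact add_eq_zero_iff_eq_neg'.2 h1
  refine ⟨X ^ k + (p : ℂ[X]), ⟨monic_X_pow_add hpk, ?_, ho⟩, ?_⟩
  · exact natDegree_eq_of_degree_eq_some
      ((degree_add_eq_left_of_degree_lt (by simpa using hpk)).trans (degree_X_pow k))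
  · rintro Q ⟨hQ, hQk, hQo⟩
    have hd : (Q - (X ^ k + (p : ℂ[X]))) ∈ degreeLT ℂ k := by
      have h1 : Q - X ^ k ∈ degreeLT ℂ k := by
        rw [mem_degreeLT]
        have hdeg : Q.degree = k := by rw [degree_eq_natDegree hQ.ne_zero, hQk]
        have := degree_sub_lt_left (p := Q) (q := X ^ k) (by rw [hdeg, degree_X_pow]) hQ.ne_zero
          (by rw [hQ.leadingCoeff, leadingCoeff_X_pow])
        rwa [hdeg] at this
      have := Submodule.sub_mem _ h1 p.2
      rwa [sub_sub] at this
    refine sub_eq_zero.1 (eq_zero_of_orthogonal hσ hd fun j hj => ?_)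
    simp_rw [eval_sub, mul_sub]
    rw [integral_sub (integrable_cis_mul_eval hσ _ _) (integrable_cis_mul_eval hσ _ _), hQo j hj,
      ho j hj, sub_zero]

/-- The monic orthogonal polynomial `Φ_k` of degree `k` on the unit circle with respect to `σ`
(see `existsUnique_isMonicOrthogonal`). -/
def monicOP (σ : Measure ℝ) (k : ℕ) : ℂ[X] := Classical.epsilon (IsMonicOrthogonal σ k)

theorem monicOP_spec {σ : Measure ℝ} (hσ : IsSzegoMeasure σ) (k : ℕ) :
    IsMonicOrthogonal σ k (monicOP σ k) :=
  Classical.epsilon_spec (existsUnique_isMonicOrthogonal hσ k).exists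

/-- The reversed polynomial `P^*(z) = z^k \overline{P}(1/z)` of a polynomial `P` of degree `k`. -/
def starPoly (k : ℕ) (P : ℂ[X]) : ℂ[X] := (P.map (starRingEnd ℂ)).reflect k

/-- The para-orthogonal polynomial `z Φ_k + κ Φ_k^*`, of degree `k + 1`. -/
def paraOrthogonal (σ : Measure ℝ) (k : ℕ) (κ : ℂ) : ℂ[X] :=
  X * monicOP σ k + C κ * starPoly k (monicOP σ k)

/-- `∏ (z - e^{iφ_s})`. -/
def nodePoly {n : ℕ} (φ : Fin n → ℝ) : ℂ[X] := ∏ s, (X - C (cis (φ s)))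

/-- The angles are increasing, `0 ≤ φ_1 < φ_2 < … < φ_n < 2π`. -/
def IsAngleList {n : ℕ} (φ : Fin n → ℝ) : Prop :=
  StrictMono φ ∧ ∀ s, φ s ∈ Ico 0 (2 * Real.pi)

/-- `t` is a real trigonometric polynomial of degree at most `d`. -/
def IsTrigPoly (d : ℕ) (t : ℝ → ℝ) : Prop :=
  ∃ a b : ℕ → ℝ, ∀ θ, t θ =
    ∑ k ∈ Finset.range (d + 1), (a k * Real.cos (k * θ) + b k * Real.sin (k * θ))

/-- `φ_1, …, φ_n` are the nodes of a positive `(d, n, dσ)` quadrature formula: with some positive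
weights the formula is exact for all trigonometric polynomials of degree at most `d`. -/
def GeneratesPositiveQF (σ : Measure ℝ) (d : ℕ) {n : ℕ} (φ : Fin n → ℝ) : Prop :=
  IsAngleList φ ∧ ∃ μ : Fin n → ℝ, (∀ s, 0 < μ s) ∧
    ∀ t : ℝ → ℝ, IsTrigPoly d t → 1 / (2 * Real.pi) * ∫ θ, t θ ∂σ = ∑ s, μ s * t (φ s)

/-- `T = z q Φ_k + η q^* Φ_k^*`, where `q` is monic of degree `l` with all zeros in the open unit
disk and `|η| = 1`. -/
def IsRepresentation (σ : Measure ℝ) (k l : ℕ) (T q : ℂ[X]) (η : ℂ) : Prop :=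
  q.Monic ∧ q.natDegree = l ∧ (∀ z, q.IsRoot z → ‖z‖ < 1) ∧ ‖η‖ = 1 ∧
    T = X * q * monicOP σ k + C η * starPoly l q * starPoly k (monicOP σ k)

/-- `e^{iα}` and `e^{iβ}`, `α < β`, are consecutive zeros of `P` on the unit circle: the open arc
from `e^{iα}` to `e^{iβ}` has no zeros of `P`. If `P` has only one zero on the circle, then
`β = α + 2π`. -/
def IsZeroArc (P : ℂ[X]) (α β : ℝ) : Prop :=
  α < β ∧ P.IsRoot (cis α) ∧ P.IsRoot (cis β) ∧ ∀ θ ∈ Ioo α β, ¬ P.IsRoot (cis θ)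

end

/-! Write `k = n - 1 - l` and `⟨p, q⟩ = ∫ p q̄` on the circle (`szegoForm`). Multiplication by `z`
is an isometry for this form, and `P = zΦ_k + κΦ_k^*` is orthogonal to `z, …, z^k`.

A positive quadrature formula is a discrete measure with the moments of `σ` up to order `n - 1 - m ≥
k`. Orthogonality of `Φ_k` involves only moments of order at most `k`, so `Φ_k` is also orthogonal
for the discrete measure (`IsMonicOrthogonal.of_moments`).

Separation: for consecutive zeros `a, b` of `P`, put `P = (z - a)(z - b)R`. At points of the circle
outside the arc, `P` times the conjugate of `zR` is a fixed constant times a nonnegative number. If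
the arc had no node, the vanishing of `⟨P, zR⟩` would make `P` vanish at all `n` nodes, so `P = T_n`
by degree (`isRoot_of_not_mem_arc`).

Representation: `T_n` is null for the discrete form, hence equals `zΦ_{n-1} + ηΦ_{n-1}^*` with the
discrete `Φ_{n-1}`. Unwinding `l` steps of the Szegő recursion produces `q_l`, itself built by a
recursion of the same kind with coefficients of modulus less than one, which keeps its zeros in the
disk.

The zeros of `P` are simple and unimodular because two zeros symmetric in the circle would give a
nonzero polynomial of norm zero. Part (3) is the separation statement for the Gauss–Szegő formula at
the zeros of `zΦ_{n-1} + ηΦ_{n-1}^*` (`IsMonicOrthogonal.exists_weights`). -/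

theorem conj_cis (θ : ℝ) : (starRingEnd ℂ) (cis θ) = cis (-θ) := by
  simp [cis, ← Complex.exp_conj]

theorem cis_natCast_mul (j : ℕ) (θ : ℝ) : cis (j * θ) = cis θ ^ j := by
  simp only [cis, ← Complex.exp_nat_mul]
  push_cast
  ring_nf

theorem cis_ne_zero (θ : ℝ) : cis θ ≠ 0 := Complex.exp_ne_zero _

theorem conj_cis_mul_cis (θ : ℝ) : (starRingEnd ℂ) (cis θ) * cis θ = 1 := by
  rw [Complex.conj_mul', norm_cis]
  norm_num

theorem cis_neg_natCast_mul (j : ℕ) (θ : ℝ) : cis (-(j * θ)) = (starRingEnd ℂ) (cis θ ^ j) := by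
  rw [← cis_natCast_mul, conj_cis]

/-! ### Algebra of the reversed polynomial -/

section starPoly

theorem starPoly_add (k : ℕ) (p q : ℂ[X]) :
    starPoly k (p + q) = starPoly k p + starPoly k q := by
  simp [starPoly, reflect_add]

theorem starPoly_C_mul (k : ℕ) (c : ℂ) (p : ℂ[X]) :
    starPoly k (C c * p) = C ((starRingEnd ℂ) c) * starPoly k p := by
  simp [starPoly]

theorem starPoly_mul {k l : ℕ} {p q : ℂ[X]} (hp : p.natDegree ≤ k) (hq : q.natDegree ≤ l) :
    starPoly (k + l) (p * q) = starPoly k p * starPoly l q := by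
  simp only [starPoly, Polynomial.map_mul]
  exact reflect_mul _ _ (natDegree_map_le.trans hp) (natDegree_map_le.trans hq)

theorem coeff_starPoly (k : ℕ) (p : ℂ[X]) (i : ℕ) :
    (starPoly k p).coeff i = (starRingEnd ℂ) (p.coeff (revAt k i)) := by
  simp [starPoly, coeff_reflect]

theorem starPoly_starPoly (k : ℕ) (p : ℂ[X]) : starPoly k (starPoly k p) = p := by
  ext i
  simp [coeff_starPoly]

theorem natDegree_starPoly_le {k : ℕ} {p : ℂ[X]} (hp : p.natDegree ≤ k) :
    (starPoly k p).natDegree ≤ k := by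
  rw [natDegree_le_iff_coeff_eq_zero]
  intro i hi
  rw [coeff_starPoly, revAt_eq_self_of_lt hi, coeff_eq_zero_of_natDegree_lt (by omega), map_zero]

theorem coeff_zero_starPoly {p : ℂ[X]} {k : ℕ} (hp : p.Monic) (hk : p.natDegree = k) :
    (starPoly k p).coeff 0 = 1 := by
  rw [coeff_starPoly, revAt_le (Nat.zero_le _), Nat.sub_zero, ← hk, hp.coeff_natDegree, map_one]

theorem starPoly_zero_one : starPoly 0 1 = 1 := by
  ext i
  rcases i with _ | i
  · simp [coeff_starPoly]
  · simp [coeff_starPoly, revAt_eq_self_of_lt, coeff_one]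

theorem starPoly_one_X : starPoly 1 X = 1 := by
  simp [starPoly]

theorem starPoly_one_one : starPoly 1 1 = X := by
  rw [← starPoly_one_X, starPoly_starPoly]

theorem starPoly_succ_X_mul {k : ℕ} {p : ℂ[X]} (hp : p.natDegree ≤ k) :
    starPoly (k + 1) (X * p) = starPoly k p := by
  rw [add_comm, starPoly_mul natDegree_X_le hp, starPoly_one_X, one_mul]

theorem starPoly_succ {k : ℕ} {p : ℂ[X]} (hp : p.natDegree ≤ k) :
    starPoly (k + 1) p = X * starPoly k p := by
  rw [← one_mul p, add_comm, starPoly_mul (by simp) hp, starPoly_one_one, one_mul]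

theorem eval_starPoly {k : ℕ} {p : ℂ[X]} (hp : p.natDegree ≤ k) {z : ℂ} (hz : z ≠ 0) :
    (starPoly k p).eval z = z ^ k * (starRingEnd ℂ) (p.eval ((starRingEnd ℂ) z)⁻¹) := by
  have hz' : z⁻¹ ≠ 0 := inv_ne_zero hz
  let : Invertible z⁻¹ := invertibleOfNonzero hz'
  have h := eval₂_reflect_mul_pow (RingHom.id ℂ) z⁻¹ k (p.map (starRingEnd ℂ))
    (natDegree_map_le.trans hp)
  simp only [invOf_eq_inv, inv_inv, eval₂_id] at h
  have h2 : (p.map (starRingEnd ℂ)).eval z⁻¹ =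
      (starRingEnd ℂ) (p.eval ((starRingEnd ℂ) z)⁻¹) := by
    rw [← eval₂_hom, eval_map, map_inv₀, Complex.conj_conj]
  rw [starPoly, ← h2, ← h, mul_left_comm, ← mul_pow, mul_inv_cancel₀ hz, one_pow, mul_one]

theorem eval_cis_starPoly {k : ℕ} {p : ℂ[X]} (hp : p.natDegree ≤ k) (θ : ℝ) :
    (starPoly k p).eval (cis θ) = cis θ ^ k * (starRingEnd ℂ) (p.eval (cis θ)) := by
  rw [eval_starPoly hp (cis_ne_zero θ), inv_eq_of_mul_eq_one_right (conj_cis_mul_cis θ)]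

end starPoly

/-! ### The sesquilinear form, para-orthogonality and the Szegő recursion -/

noncomputable section

/-- The sesquilinear form `⟨p, q⟩ = ∫ p \overline{q} dρ` on polynomials restricted to the unit
circle. -/
def szegoForm (ρ : Measure ℝ) (p q : ℂ[X]) : ℂ :=
  ∫ θ, (starRingEnd ℂ) (q.eval (cis θ)) * p.eval (cis θ) ∂ρ

end

section form

variable {ρ : Measure ℝ}

theorem norm_eval_cis_le (p : ℂ[X]) (θ : ℝ) :
    ‖p.eval (cis θ)‖ ≤ ∑ i ∈ p.support, ‖p.coeff i‖ := by
  rw [Polynomial.eval_eq_sum, Polynomial.sum]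
  refine (norm_sum_le _ _).trans (le_of_eq ?_)
  simp [norm_cis]

theorem continuous_eval_cis (p : ℂ[X]) : Continuous fun θ => p.eval (cis θ) :=
  p.continuous.comp continuous_cis

theorem integrable_szegoForm [IsFiniteMeasure ρ] (p q : ℂ[X]) :
    Integrable (fun θ => (starRingEnd ℂ) (q.eval (cis θ)) * p.eval (cis θ)) ρ := by
  refine Integrable.of_bound (C := (∑ i ∈ q.support, ‖q.coeff i‖) * ∑ i ∈ p.support, ‖p.coeff i‖)
    ((Complex.continuous_conj.comp (continuous_eval_cis q)).mul
      (continuous_eval_cis p)).aestronglyMeasurable (Filter.Eventually.of_forall fun θ => ?_)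
  rw [norm_mul, RCLike.norm_conj]
  exact mul_le_mul (norm_eval_cis_le q θ) (norm_eval_cis_le p θ) (norm_nonneg _)
    (Finset.sum_nonneg fun i _ => norm_nonneg _)

theorem szegoForm_add_left [IsFiniteMeasure ρ] (p q r : ℂ[X]) :
    szegoForm ρ (p + q) r = szegoForm ρ p r + szegoForm ρ q r := by
  simp only [szegoForm, eval_add, mul_add]
  exact integral_add (integrable_szegoForm _ _) (integrable_szegoForm _ _)

theorem szegoForm_C_mul_left (c : ℂ) (p r : ℂ[X]) :
    szegoForm ρ (C c * p) r = c * szegoForm ρ p r := by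
  simp only [szegoForm, eval_mul, eval_C, ← integral_const_mul]
  congr 1
  ext θ
  ring

theorem szegoForm_conj (p q : ℂ[X]) :
    (starRingEnd ℂ) (szegoForm ρ p q) = szegoForm ρ q p := by
  simp only [szegoForm, ← integral_conj]
  congr 1
  ext θ
  rw [map_mul, Complex.conj_conj, mul_comm]

theorem szegoForm_add_right [IsFiniteMeasure ρ] (p q r : ℂ[X]) :
    szegoForm ρ p (q + r) = szegoForm ρ p q + szegoForm ρ p r := by
  rw [← szegoForm_conj, szegoForm_add_left, map_add, szegoForm_conj, szegoForm_conj]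

theorem szegoForm_C_mul_right (c : ℂ) (p r : ℂ[X]) :
    szegoForm ρ p (C c * r) = (starRingEnd ℂ) c * szegoForm ρ p r := by
  rw [← szegoForm_conj, szegoForm_C_mul_left, map_mul, szegoForm_conj]

theorem szegoForm_sub_left [IsFiniteMeasure ρ] (p q r : ℂ[X]) :
    szegoForm ρ (p - q) r = szegoForm ρ p r - szegoForm ρ q r := by
  have := szegoForm_add_left (ρ := ρ) (p - q) q r
  rw [sub_add_cancel] at this
  rw [this, add_sub_cancel_right]

theorem szegoForm_sub_right [IsFiniteMeasure ρ] (p q r : ℂ[X]) :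
    szegoForm ρ p (q - r) = szegoForm ρ p q - szegoForm ρ p r := by
  rw [← szegoForm_conj, szegoForm_sub_left, map_sub, szegoForm_conj, szegoForm_conj]

theorem szegoForm_zero_left (r : ℂ[X]) : szegoForm ρ 0 r = 0 := by simp [szegoForm]

theorem szegoForm_zero_right (r : ℂ[X]) : szegoForm ρ r 0 = 0 := by simp [szegoForm]

theorem szegoForm_X_mul (p q : ℂ[X]) : szegoForm ρ (X * p) (X * q) = szegoForm ρ p q := by
  simp only [szegoForm, eval_mul, eval_X, map_mul]
  congr 1
  ext θ
  linear_combination (starRingEnd ℂ) (q.eval (cis θ)) * p.eval (cis θ) * conj_cis_mul_cis θ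

/-- On the circle `p^* = z^k p̄`, so the unimodular factors cancel and conjugation swaps the two
arguments. -/
theorem szegoForm_starPoly {k : ℕ} {p q : ℂ[X]} (hp : p.natDegree ≤ k) (hq : q.natDegree ≤ k) :
    szegoForm ρ (starPoly k p) (starPoly k q) = szegoForm ρ q p := by
  simp only [szegoForm, eval_cis_starPoly hp, eval_cis_starPoly hq, map_mul, map_pow]
  congr 1
  ext θ
  have h : (starRingEnd ℂ) (cis θ) ^ k * cis θ ^ k = 1 := by
    rw [← mul_pow, conj_cis_mul_cis, one_pow]
  rw [Complex.conj_conj]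
  linear_combination (starRingEnd ℂ) (p.eval (cis θ)) * q.eval (cis θ) * h

/-- On the circle the conjugate of `z - a` is `-ā z̄ (z - b)` with `b = 1/ā`. A linear factor thus
crosses the form and becomes the factor of the reflected point. -/
theorem szegoForm_X_sub_C_mul_right {a b : ℂ} (hab : (starRingEnd ℂ) a * b = 1) (p q : ℂ[X]) :
    szegoForm ρ p ((X - C a) * q) =
      -(starRingEnd ℂ) a * szegoForm ρ ((X - C b) * p) (X * q) := by
  simp only [szegoForm, ← integral_const_mul, eval_mul, eval_sub, eval_X, eval_C, map_mul, map_sub]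
  congr 1
  ext θ
  linear_combination (starRingEnd ℂ) (q.eval (cis θ)) * p.eval (cis θ) *
    ((starRingEnd ℂ) a * conj_cis_mul_cis θ - (starRingEnd ℂ) (cis θ) * hab)

theorem szegoForm_self (p : ℂ[X]) :
    szegoForm ρ p p = ((∫ θ, ‖p.eval (cis θ)‖ ^ 2 ∂ρ : ℝ) : ℂ) := by
  rw [← integral_complex_ofReal, szegoForm]
  congr 1
  ext θ
  rw [Complex.conj_mul']
  push_cast
  rfl

theorem szegoForm_eq_zero_of_degree_lt [IsFiniteMeasure ρ] {k : ℕ} {p q : ℂ[X]}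
    (h : ∀ j < k, szegoForm ρ p (X ^ j) = 0) (hq : q.degree < k) : szegoForm ρ p q = 0 := by
  have key : ∀ s : Finset ℕ, (∀ i ∈ s, i < k) →
      szegoForm ρ p (∑ i ∈ s, C (q.coeff i) * X ^ i) = 0 := by
    intro s
    induction s using Finset.induction_on with
    | empty => intro _; simp [szegoForm_zero_right]
    | insert a s ha ih =>
      intro hs
      rw [Finset.sum_insert ha, szegoForm_add_right, szegoForm_C_mul_right,
        h a (hs a (Finset.mem_insert_self a s)),
        ih fun i hi => hs i (Finset.mem_insert_of_mem hi), mul_zero, add_zero]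
  rw [q.as_sum_support_C_mul_X_pow]
  refine key _ fun i hi => ?_
  exact_mod_cast (le_degree_of_mem_supp i hi).trans_lt hq

theorem IsMonicOrthogonal.szegoForm_eq_zero [IsFiniteMeasure ρ] {k : ℕ} {Φ q : ℂ[X]}
    (h : IsMonicOrthogonal ρ k Φ) (hq : q.degree < k) : szegoForm ρ Φ q = 0 := by
  refine szegoForm_eq_zero_of_degree_lt (fun j hj => ?_) hq
  rw [← h.2.2 j hj, szegoForm]
  simp only [cis_neg_natCast_mul, eval_pow, eval_X]

theorem isMonicOrthogonal_of_szegoForm {k : ℕ} {Φ : ℂ[X]} (hm : Φ.Monic) (hd : Φ.natDegree = k)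
    (h : ∀ j < k, szegoForm ρ Φ (X ^ j) = 0) : IsMonicOrthogonal ρ k Φ := by
  refine ⟨hm, hd, fun j hj => ?_⟩
  rw [← h j hj, szegoForm]
  simp only [cis_neg_natCast_mul, eval_pow, eval_X]

/-- `X Φ + c Φ^*` is orthogonal to `z, …, z^k`. -/
theorem IsMonicOrthogonal.szegoForm_para [IsFiniteMeasure ρ] {k : ℕ} {Φ r : ℂ[X]}
    (h : IsMonicOrthogonal ρ k Φ) (c : ℂ) (hr : r.degree < k) :
    szegoForm ρ (X * Φ + C c * starPoly k Φ) (X * r) = 0 := by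
  rcases k with _ | k
  · have : r = 0 := by simpa using hr
    rw [this, mul_zero, szegoForm_zero_right]
  have hr' : r.natDegree ≤ k := by
    rw [natDegree_le_iff_coeff_eq_zero]
    exact (degree_lt_iff_coeff_zero _ _).1 hr
  have hX : (X * r).natDegree ≤ k + 1 := by
    refine natDegree_mul_le.trans ?_
    rw [natDegree_X]
    omega
  -- Reversal in degree `k + 1` turns `⟨Φ^*, z r⟩` into `⟨r^*, Φ⟩`, where `r^*` has degree below
  -- that of `Φ`.
  rw [szegoForm_add_left, szegoForm_C_mul_left, szegoForm_X_mul, h.szegoForm_eq_zero hr,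
    ← starPoly_starPoly (k + 1) (X * r), szegoForm_starPoly h.2.1.le (natDegree_starPoly_le hX),
    starPoly_succ_X_mul hr', ← szegoForm_conj, h.szegoForm_eq_zero, map_zero, mul_zero, add_zero]
  exact (natDegree_le_iff_degree_le.1 (natDegree_starPoly_le hr')).trans_lt
    (by exact_mod_cast Nat.lt_succ_self k)

theorem natDegree_para {k : ℕ} {Φ : ℂ[X]} (hm : Φ.Monic) (hd : Φ.natDegree = k) (c : ℂ) :
    (X * Φ + C c * starPoly k Φ).Monic ∧ (X * Φ + C c * starPoly k Φ).natDegree = k + 1 := by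
  have h1 : (X * Φ).natDegree = k + 1 := by
    rw [monic_X.natDegree_mul hm, natDegree_X, hd, add_comm]
  have h2 : (C c * starPoly k Φ).natDegree < (X * Φ).natDegree := by
    rw [h1]
    exact Nat.lt_succ_of_le ((natDegree_C_mul_le _ _).trans (natDegree_starPoly_le hd.le))
  refine ⟨(monic_X.mul hm).add_of_left (degree_lt_degree h2), ?_⟩
  rw [natDegree_add_eq_left_of_natDegree_lt h2, h1]

/-- A polynomial that is, like `z Φ`, monic and orthogonal to `z, …, z^k` is `z Φ + c Φ^*`. -/
theorem IsMonicOrthogonal.eq_para [IsFiniteMeasure ρ] {k : ℕ} {Φ Q : ℂ[X]}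
    (h : IsMonicOrthogonal ρ k Φ)
    (hdef : ∀ p : ℂ[X], p.degree < k → szegoForm ρ p p = 0 → p = 0)
    (hm : Q.Monic) (hd : Q.natDegree = k + 1)
    (hQ : ∀ r : ℂ[X], r.degree < k → szegoForm ρ Q (X * r) = 0) :
    Q = X * Φ + C (Q.coeff 0) * starPoly k Φ := by
  have hpara := natDegree_para h.1 h.2.1 (Q.coeff 0)
  -- The difference vanishes at `0` and its leading terms cancel, so it is `zH` with `deg H < k`.
  -- Both terms are orthogonal to `zH`, hence `H` has norm zero.
  set G := Q - (X * Φ + C (Q.coeff 0) * starPoly k Φ) with hG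
  have h0 : G.coeff 0 = 0 := by
    simp [hG, coeff_zero_starPoly h.1 h.2.1]
  have hGX : G = X * G.divX := by
    conv_lhs => rw [← X_mul_divX_add G, h0, C_0, add_zero]
  have hGd : G.degree < (k + 1 : ℕ) := by
    have hQd : Q.degree = (k + 1 : ℕ) := by rw [degree_eq_natDegree hm.ne_zero, hd]
    have := degree_sub_lt_left (p := Q) (q := X * Φ + C (Q.coeff 0) * starPoly k Φ)
      (by rw [hQd, degree_eq_natDegree hpara.1.ne_zero, hpara.2]) hm.ne_zero
      (by rw [hm.leadingCoeff, hpara.1.leadingCoeff])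
    rwa [hQd] at this
  have hH : G.divX.degree < k := by
    rw [degree_lt_iff_coeff_zero] at hGd ⊢
    intro i hi
    rw [coeff_divX]
    exact hGd (i + 1) (by omega)
  have hz : szegoForm ρ G.divX G.divX = 0 := by
    rw [← szegoForm_X_mul, ← hGX]
    nth_rewrite 2 [hGX]
    rw [hG, szegoForm_sub_left, hQ _ hH, h.szegoForm_para _ hH, sub_zero]
  rw [hdef _ hH hz, mul_zero] at hGX
  exact sub_eq_zero.1 hGX

theorem szegoForm_self_re_nonneg (p : ℂ[X]) : 0 ≤ (szegoForm ρ p p).re := by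
  rw [szegoForm_self, Complex.ofReal_re]
  exact integral_nonneg fun θ => by positivity

theorem szegoForm_self_eq_re (p : ℂ[X]) : szegoForm ρ p p = (szegoForm ρ p p).re := by
  rw [szegoForm_self, Complex.ofReal_re]

/-- The Szegő recursion. -/
theorem IsMonicOrthogonal.exists_succ [IsFiniteMeasure ρ] {k : ℕ} {Φ : ℂ[X]}
    (h : IsMonicOrthogonal ρ k Φ)
    (hdef : ∀ p : ℂ[X], p.degree < (k + 2 : ℕ) → szegoForm ρ p p = 0 → p = 0) :
    ∃ c : ℂ, ‖c‖ < 1 ∧ IsMonicOrthogonal ρ (k + 1) (X * Φ + C c * starPoly k Φ) := by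
  have hpos : ∀ p : ℂ[X], p.Monic → p.natDegree < k + 2 → 0 < (szegoForm ρ p p).re := by
    intro p hp hd
    refine (szegoForm_self_re_nonneg p).lt_of_ne fun h0 => hp.ne_zero (hdef p ?_ ?_)
    · rw [degree_eq_natDegree hp.ne_zero]
      exact_mod_cast hd
    · rw [szegoForm_self_eq_re, ← h0, Complex.ofReal_zero]
  have hΦ := hpos Φ h.1 (by rw [h.2.1]; omega)
  have hΦ0 : szegoForm ρ Φ Φ ≠ 0 := by
    rw [szegoForm_self_eq_re]
    exact_mod_cast hΦ.ne'
  have hstar := szegoForm_starPoly (ρ := ρ) h.2.1.le h.2.1.le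
  -- This `c` makes the new polynomial orthogonal to `Φ^*`. Since `Φ^*(0) = 1` and the rest of `Φ^*`
  -- is a multiple of `z`, orthogonality to `1` follows.
  set c := -szegoForm ρ (X * Φ) (starPoly k Φ) / szegoForm ρ Φ Φ with hc
  obtain ⟨hm, hd⟩ := natDegree_para h.1 h.2.1 c
  have hpara := fun r => h.szegoForm_para (r := r) c
  have hXs : szegoForm ρ (X * Φ) (starPoly k Φ) = -c * szegoForm ρ Φ Φ := by
    rw [hc]
    field_simp
  have hs : szegoForm ρ (X * Φ + C c * starPoly k Φ) (starPoly k Φ) = 0 := by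
    rw [szegoForm_add_left, szegoForm_C_mul_left, hstar, hXs]
    ring
  have h1 : szegoForm ρ (X * Φ + C c * starPoly k Φ) 1 = 0 := by
    rw [← hs]
    nth_rewrite 3 [← X_mul_divX_add (starPoly k Φ)]
    rw [szegoForm_add_right, hpara, coeff_zero_starPoly h.1 h.2.1, C_1, zero_add]
    rw [degree_lt_iff_coeff_zero]
    intro i hi
    rw [coeff_divX]
    exact coeff_eq_zero_of_natDegree_lt
      ((natDegree_starPoly_le h.2.1.le).trans_lt (by omega))
  have horth : IsMonicOrthogonal ρ (k + 1) (X * Φ + C c * starPoly k Φ) := by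
    refine isMonicOrthogonal_of_szegoForm hm hd fun j hj => ?_
    rcases j with _ | j
    · rwa [pow_zero]
    · rw [pow_succ']
      refine hpara _ ?_
      rw [degree_X_pow]
      exact_mod_cast (by omega : j < k)
  refine ⟨c, ?_, horth⟩
  -- Positivity of the norm of the new polynomial, which has degree `k + 1`, gives `|c| < 1`; hence
  -- definiteness is needed below degree `k + 2`.
  have hself : szegoForm ρ (X * Φ + C c * starPoly k Φ) (X * Φ + C c * starPoly k Φ) =
      (1 - c * (starRingEnd ℂ) c) * szegoForm ρ Φ Φ := by
    rw [szegoForm_add_right, szegoForm_C_mul_right, hs, mul_zero, add_zero, szegoForm_add_left,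
      szegoForm_X_mul, szegoForm_C_mul_left, ← szegoForm_conj (X * Φ) (starPoly k Φ), hXs, map_mul,
      map_neg, szegoForm_conj]
    ring
  have hpos' := hpos _ hm (by rw [hd]; omega)
  rw [hself, szegoForm_self_eq_re Φ, Complex.mul_conj'] at hpos'
  have : 0 < (1 - ‖c‖ ^ 2) * (szegoForm ρ Φ Φ).re := by
    exact_mod_cast hpos'
  have h2 := pos_of_mul_pos_left this hΦ.le
  nlinarith [norm_nonneg c]

end form

/-! ### Zeros of orthogonal and para-orthogonal polynomials -/

section zeros

variable {ρ : Measure ℝ}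

theorem starPoly_para {k : ℕ} {p : ℂ[X]} (hp : p.natDegree ≤ k) (c : ℂ) :
    starPoly (k + 1) (X * p + C c * starPoly k p) =
      C ((starRingEnd ℂ) c) * (X * p) + starPoly k p := by
  rw [starPoly_add, starPoly_C_mul, starPoly_succ_X_mul hp, starPoly_succ (natDegree_starPoly_le hp),
    starPoly_starPoly, add_comm]

theorem conj_mul_self_of_norm_eq_one {κ : ℂ} (hκ : ‖κ‖ = 1) : (starRingEnd ℂ) κ * κ = 1 := by
  rw [Complex.conj_mul', hκ]
  norm_num

theorem cis_add_two_pi_mul_int (θ : ℝ) (k : ℤ) : cis (θ + 2 * Real.pi * k) = cis θ := by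
  unfold cis
  rw [Complex.exp_eq_exp_iff_exists_int]
  exact ⟨k, by push_cast; ring⟩

theorem cis_eq_cis_iff {x y : ℝ} : cis x = cis y ↔ ∃ k : ℤ, x = y + 2 * Real.pi * k := by
  constructor
  · intro h
    obtain ⟨k, hk⟩ := Complex.exp_eq_exp_iff_exists_int.1 h
    refine ⟨k, ?_⟩
    have := congrArg Complex.im hk
    simp only [Complex.add_im, Complex.mul_im] at this
    simp at this
    linarith
  · rintro ⟨k, rfl⟩
    exact cis_add_two_pi_mul_int y k

theorem exists_cis_eq {z : ℂ} (hz : ‖z‖ = 1) (α : ℝ) :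
    ∃ θ ∈ Ico α (α + 2 * Real.pi), cis θ = z := by
  refine ⟨toIcoMod Real.two_pi_pos α z.arg, toIcoMod_mem_Ico _ _ _, ?_⟩
  have h : cis z.arg = z := by
    have := Complex.norm_mul_exp_arg_mul_I z
    rwa [hz, Complex.ofReal_one, one_mul] at this
  refine (cis_eq_cis_iff.2 ⟨-toIcoDiv Real.two_pi_pos α z.arg, ?_⟩).trans h
  rw [toIcoMod, zsmul_eq_mul]
  push_cast
  ring

theorem monic_nodePoly {n : ℕ} (φ : Fin n → ℝ) : (nodePoly φ).Monic :=
  monic_prod_of_monic _ _ fun _ _ => monic_X_sub_C _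

theorem natDegree_nodePoly {n : ℕ} (φ : Fin n → ℝ) : (nodePoly φ).natDegree = n := by
  rw [nodePoly, natDegree_prod_of_monic _ _ fun _ _ => monic_X_sub_C _]
  simp

theorem isRoot_nodePoly {n : ℕ} {φ : Fin n → ℝ} {z : ℂ} :
    (nodePoly φ).IsRoot z ↔ ∃ s, z = cis (φ s) := by
  simp [nodePoly, IsRoot.def, eval_prod, Finset.prod_eq_zero_iff, sub_eq_zero]

theorem IsAngleList.injective_cis {n : ℕ} {φ : Fin n → ℝ} (h : IsAngleList φ) :
    Function.Injective fun s => cis (φ s) :=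
  fun s t hst => h.1.injective (injOn_cis (h.2 s) (h.2 t) hst)

/-- A monic polynomial with simple zeros on the unit circle is given by its list of angles. -/
theorem exists_angleList {m : ℕ} {Q : ℂ[X]} (hm : Q.Monic) (hd : Q.natDegree = m)
    (hroot : ∀ z, Q.IsRoot z → ‖z‖ = 1) (hnd : Q.roots.Nodup) :
    ∃ ψ : Fin m → ℝ, IsAngleList ψ ∧ Q = nodePoly ψ := by
  classical
  have hr : ∀ z ∈ Q.roots.toFinset, ‖z‖ = 1 := fun z hz =>
    hroot z ((mem_roots hm.ne_zero).1 (Multiset.mem_toFinset.1 hz))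
  choose! g hg hgc using fun z (hz : ‖z‖ = 1) => exists_cis_eq hz 0
  have hinj : InjOn g Q.roots.toFinset := fun x hx y hy hxy => by
    rw [← hgc x (hr x hx), ← hgc y (hr y hy), hxy]
  have hcard : (Q.roots.toFinset.image g).card = m := by
    rw [Finset.card_image_of_injOn hinj, Multiset.toFinset_card_of_nodup hnd, ← hd]
    exact (splits_iff_card_roots.1 (IsAlgClosed.splits Q))
  set ψ := (Q.roots.toFinset.image g).orderEmbOfFin hcard with hψ
  refine ⟨ψ, ⟨ψ.strictMono, fun s => ?_⟩, ?_⟩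
  · obtain ⟨z, hz, hzs⟩ := Finset.mem_image.1
      ((Q.roots.toFinset.image g).orderEmbOfFin_mem hcard s)
    rw [hψ, ← hzs]
    simpa using hg z (hr z hz)
  · have h1 : nodePoly ψ = ∏ θ ∈ Q.roots.toFinset.image g, (X - C (cis θ)) := by
      rw [nodePoly, ← Finset.image_orderEmbOfFin_univ (Q.roots.toFinset.image g) hcard,
        Finset.prod_image fun x _ y _ h => ψ.injective h]
    rw [h1, Finset.prod_image hinj, Finset.prod_congr rfl fun z hz => by rw [hgc z (hr z hz)]]
    conv_lhs => rw [(IsAlgClosed.splits Q).eq_prod_roots_of_monic hm]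
    rw [Finset.prod, Multiset.toFinset_val, Multiset.dedup_eq_self.2 hnd]

/-- Para-orthogonal polynomials cannot have a pair of zeros symmetric in the unit circle. -/
theorem IsMonicOrthogonal.not_symmetric_dvd_para [IsFiniteMeasure ρ] {k : ℕ} {Φ : ℂ[X]}
    (h : IsMonicOrthogonal ρ k Φ) (hdef : ∀ p : ℂ[X], szegoForm ρ p p = 0 → p = 0) (κ : ℂ)
    {a b : ℂ} (hab : (starRingEnd ℂ) a * b = 1) :
    ¬ (X - C b) * (X - C a) ∣ X * Φ + C κ * starPoly k Φ := by
  rintro ⟨R, hR⟩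
  obtain ⟨hm, hd⟩ := natDegree_para h.1 h.2.1 κ
  have hab' : ((X - C b) * (X - C a)).Monic := (monic_X_sub_C b).mul (monic_X_sub_C a)
  have hR0 : R ≠ 0 := by
    rintro rfl
    rw [mul_zero] at hR
    exact hm.ne_zero hR
  have hRd : R.degree < k := by
    have := congrArg natDegree hR
    rw [hd, hab'.natDegree_mul' hR0, (monic_X_sub_C b).natDegree_mul (monic_X_sub_C a),
      natDegree_X_sub_C, natDegree_X_sub_C] at this
    rw [degree_eq_natDegree hR0]
    exact_mod_cast (by omega : R.natDegree < k)
  -- Moving one factor `z - a` across rebuilds the para-orthogonal polynomial on the left, against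
  -- `zR`.
  have hz : szegoForm ρ ((X - C a) * R) ((X - C a) * R) = 0 := by
    rw [szegoForm_X_sub_C_mul_right hab, ← mul_assoc, ← hR, h.szegoForm_para κ hRd, mul_zero]
  exact mul_ne_zero (X_sub_C_ne_zero a) hR0 (hdef _ hz)

theorem IsMonicOrthogonal.para_zeros [IsFiniteMeasure ρ] {k : ℕ} {Φ : ℂ[X]}
    (h : IsMonicOrthogonal ρ k Φ) (hdef : ∀ p : ℂ[X], szegoForm ρ p p = 0 → p = 0) {κ : ℂ}
    (hκ : ‖κ‖ = 1) {m : ℕ} (hk : k + 1 = m) :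
    ∃ ψ : Fin m → ℝ, IsAngleList ψ ∧ X * Φ + C κ * starPoly k Φ = nodePoly ψ := by
  obtain ⟨hm, hd⟩ := natDegree_para h.1 h.2.1 κ
  have hsym := fun a b => h.not_symmetric_dvd_para hdef κ (a := a) (b := b)
  set Q := X * Φ + C κ * starPoly k Φ with hQ
  -- Self-reversal up to a constant: zeros off the circle come in pairs `a, 1/ā`.
  have hstar : starPoly (k + 1) Q = C ((starRingEnd ℂ) κ) * Q := by
    rw [hQ, starPoly_para h.2.1.le, mul_add, ← mul_assoc (C _) (C κ), ← C_mul,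
      conj_mul_self_of_norm_eq_one hκ, C_1, one_mul]
  have hκ0 : κ ≠ 0 := by
    rintro rfl
    simp at hκ
  have hroot : ∀ z, Q.IsRoot z → ‖z‖ = 1 := by
    intro a ha
    by_contra hne
    have ha0 : a ≠ 0 := by
      rintro rfl
      refine hκ0 ?_
      have : Q.coeff 0 = 0 := by rwa [coeff_zero_eq_eval_zero]
      simpa [hQ, coeff_zero_starPoly h.1 h.2.1] using this
    have hb0 : ((starRingEnd ℂ) a)⁻¹ ≠ 0 := by simpa using ha0
    have hb : Q.IsRoot ((starRingEnd ℂ) a)⁻¹ := by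
      have h1 := eval_starPoly hd.le hb0
      rw [hstar, map_inv₀, Complex.conj_conj, inv_inv, ha.eq_zero, map_zero, mul_zero, eval_mul,
        eval_C] at h1
      exact (mul_eq_zero.1 h1).resolve_left (by simpa using hκ0)
    have hne' : ((starRingEnd ℂ) a)⁻¹ ≠ a := by
      intro he
      have h2 : (starRingEnd ℂ) a * a = 1 := by
        nth_rewrite 2 [← he]
        exact mul_inv_cancel₀ (by simpa using ha0)
      rw [Complex.conj_mul'] at h2
      have h3 : ‖a‖ ^ 2 = 1 := by exact_mod_cast h2
      exact hne ((pow_eq_one_iff_of_nonneg (norm_nonneg a) two_ne_zero).1 h3)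
    refine hsym a ((starRingEnd ℂ) a)⁻¹ (mul_inv_cancel₀ (by simpa using ha0)) ?_
    exact (pairwise_coprime_X_sub_C (s := id) Function.injective_id hne').mul_dvd
      (dvd_iff_isRoot.2 hb) (dvd_iff_isRoot.2 ha)
  refine exists_angleList hm (hd.trans hk) hroot ?_
  rw [Multiset.nodup_iff_count_le_one]
  intro a
  by_contra! hc
  rw [count_roots] at hc
  have h2 : (X - C a) ^ 2 ∣ Q := (le_rootMultiplicity_iff hm.ne_zero).1 hc
  have ha : Q.IsRoot a := (rootMultiplicity_pos hm.ne_zero).1 (by omega)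
  -- A double zero on the circle is a symmetric pair with `b = a`.
  rw [sq] at h2
  exact hsym a a (conj_mul_self_of_norm_eq_one (hroot a ha)) h2

/-- Orthogonal polynomials have no zeros on the unit circle. -/
theorem IsMonicOrthogonal.not_isRoot [IsFiniteMeasure ρ] {k : ℕ} {Φ : ℂ[X]}
    (h : IsMonicOrthogonal ρ k Φ) (hdef : ∀ p : ℂ[X], szegoForm ρ p p = 0 → p = 0) {a : ℂ}
    (ha : ‖a‖ = 1) : ¬ Φ.IsRoot a := by
  intro hr
  obtain ⟨R, hR⟩ := dvd_iff_isRoot.2 hr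
  have hR0 : R ≠ 0 := by
    rintro rfl
    rw [mul_zero] at hR
    exact h.1.ne_zero hR
  have hRd : R.degree < k := by
    have := congrArg natDegree hR
    rw [h.2.1, (monic_X_sub_C a).natDegree_mul' hR0, natDegree_X_sub_C] at this
    rw [degree_eq_natDegree hR0]
    exact_mod_cast (by omega : R.natDegree < k)
  have hXR : X * R = Φ + C a * R := by
    rw [hR]
    ring
  -- Pythagoras for `zR = Φ + aR` with `|a| = 1`; since `‖zR‖ = ‖R‖`, this forces `‖Φ‖ = 0`.
  have h1 : szegoForm ρ (X * R) (X * R) = szegoForm ρ Φ Φ + szegoForm ρ R R := by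
    rw [hXR, szegoForm_add_left, szegoForm_add_right, szegoForm_add_right, szegoForm_C_mul_left,
      szegoForm_C_mul_left, szegoForm_C_mul_right, szegoForm_C_mul_right,
      h.szegoForm_eq_zero hRd, ← szegoForm_conj Φ R, h.szegoForm_eq_zero hRd, map_zero]
    linear_combination szegoForm ρ R R * conj_mul_self_of_norm_eq_one ha
  rw [szegoForm_X_mul] at h1
  exact h.1.ne_zero (hdef Φ (by linear_combination -h1))

theorem IsSzegoMeasure.eq_zero_of_szegoForm_self {σ : Measure ℝ} (hσ : IsSzegoMeasure σ) {p : ℂ[X]}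
    (hp : szegoForm σ p p = 0) : p = 0 := by
  by_contra hne
  have hfin := hσ.isFiniteMeasure
  have hI : Integrable (fun θ => ‖p.eval (cis θ)‖ ^ 2) σ := by
    refine (integrable_szegoForm p p).re.congr (Filter.Eventually.of_forall fun θ => ?_)
    simp only [Complex.conj_mul']
    norm_cast
  rw [szegoForm_self, Complex.ofReal_eq_zero,
    integral_eq_zero_iff_of_nonneg (fun θ => by positivity) hI] at hp
  refine hσ.nontrivial _ (finite_zero_angles hne) ?_
  have hA : ∀ᵐ θ ∂σ, θ ∈ Icc 0 (2 * Real.pi) := hσ.concentrated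
  have hB : ∀ᵐ θ ∂σ, θ ∈ {θ ∈ Icc 0 (2 * Real.pi) | p.IsRoot (cis θ)} := by
    filter_upwards [hA, hp] with θ h1 h2
    exact ⟨h1, by simpa using h2⟩
  exact hB

end zeros

/-! ### The representation by `q_l` -/

section representation

variable {ρ : Measure ℝ}

/-- The difference of the squared norms factors as `(1 - |d|²)(|u|² - |v|²)`. -/
theorem norm_add_conj_mul_le {u v d : ℂ} (hd : ‖d‖ ≤ 1) (h : ‖v‖ ≤ ‖u‖) :
    ‖(starRingEnd ℂ) d * u + v‖ ≤ ‖u + d * v‖ := by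
  have key : ‖u + d * v‖ ^ 2 - ‖(starRingEnd ℂ) d * u + v‖ ^ 2 =
      (1 - ‖d‖ ^ 2) * (‖u‖ ^ 2 - ‖v‖ ^ 2) := by
    simp only [Complex.sq_norm, Complex.normSq_apply, Complex.add_re, Complex.add_im,
      Complex.mul_re, Complex.mul_im, Complex.conj_re, Complex.conj_im]
    ring
  have h1 : 0 ≤ (1 - ‖d‖ ^ 2) * (‖u‖ ^ 2 - ‖v‖ ^ 2) := by
    apply mul_nonneg
    · nlinarith [norm_nonneg d]
    · nlinarith [norm_nonneg v]
  exact le_of_sq_le_sq (by linarith) (norm_nonneg _)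

/-- The Szegő recursion preserves the property of having all zeros in the open unit disk. -/
theorem eval_para_of_norm_lt_one {l : ℕ} {q : ℂ[X]} (hd : q.natDegree ≤ l) {d : ℂ} (hd1 : ‖d‖ < 1)
    {z : ℂ} (hz : 1 ≤ ‖z‖) (h0 : q.eval z ≠ 0)
    (hle : ‖(starPoly l q).eval z‖ ≤ ‖q.eval z‖) :
    (X * q + C d * starPoly l q).eval z ≠ 0 ∧
      ‖(starPoly (l + 1) (X * q + C d * starPoly l q)).eval z‖ ≤
        ‖(X * q + C d * starPoly l q).eval z‖ := by
  have hq : ‖q.eval z‖ ≤ ‖z * q.eval z‖ := by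
    rw [norm_mul]
    exact le_mul_of_one_le_left (norm_nonneg _) hz
  have hle' := hle.trans hq
  rw [starPoly_para hd]
  simp only [eval_add, eval_mul, eval_X, eval_C]
  refine ⟨fun he => ?_, norm_add_conj_mul_le hd1.le hle'⟩
  have h1 : ‖z * q.eval z‖ = ‖d‖ * ‖(starPoly l q).eval z‖ := by
    rw [eq_neg_of_add_eq_zero_left he, norm_neg, norm_mul]
  have h2 : 0 < ‖z * q.eval z‖ := (norm_pos_iff.2 h0).trans_le hq
  nlinarith [norm_nonneg ((starPoly l q).eval z), norm_nonneg d]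

/-- Induction on `l` with `k + l + 1 = n` fixed: for `l = 0` orthogonality alone determines `T`, and
each further step rewrites `Φ_{k+1}` through `Φ_k`. The bound `|q^*| ≤ |q|` outside the open disk is
carried along because it, with `q ≠ 0` there, survives the recursion for `q`. -/
theorem IsMonicOrthogonal.exists_representation [IsFiniteMeasure ρ] {n : ℕ} {T : ℂ[X]}
    (hm : T.Monic) (hd : T.natDegree = n) (h0 : ‖T.coeff 0‖ = 1)
    (hT : ∀ p, szegoForm ρ T p = 0)
    (hdef : ∀ p : ℂ[X], p.degree < n → szegoForm ρ p p = 0 → p = 0) (l : ℕ) :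
    ∀ (k : ℕ) (Φ : ℂ[X]), IsMonicOrthogonal ρ k Φ → k + l + 1 = n →
      ∃ q : ℂ[X], q.Monic ∧ q.natDegree = l ∧
        (∀ z, 1 ≤ ‖z‖ → q.eval z ≠ 0 ∧ ‖(starPoly l q).eval z‖ ≤ ‖q.eval z‖) ∧
        T = X * q * Φ + C (T.coeff 0) * starPoly l q * starPoly k Φ := by
  induction l with
  | zero =>
    intro k Φ hΦ hn
    refine ⟨1, monic_one, natDegree_one, fun z _ => by simp [starPoly_zero_one], ?_⟩
    rw [starPoly_zero_one, mul_one, mul_one]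
    refine hΦ.eq_para (fun p hp => hdef p (hp.trans ?_)) hm (by omega) fun r _ => hT _
    exact_mod_cast (by omega : k < n)
  | succ l ih =>
    intro k Φ hΦ hn
    obtain ⟨c, hc, hΦ'⟩ := hΦ.exists_succ fun p hp => hdef p (hp.trans_le (by
      exact_mod_cast (by omega : k + 2 ≤ n)))
    obtain ⟨q, hq, hql, hqz, hqT⟩ := ih (k + 1) _ hΦ' (by omega)
    -- With `η = T(0)`, the coefficient of `Φ_k` becomes `z(zq + c̄ηq^*)`. As `|η| = 1`, the
    -- coefficient `czq + ηq^*` of `Φ_k^*` is then `η(zq + dq^*)^*`.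
    set d := (starRingEnd ℂ) c * T.coeff 0 with hdc
    have hd1 : ‖d‖ < 1 := by rwa [hdc, norm_mul, RCLike.norm_conj, h0, mul_one]
    obtain ⟨hm', hd'⟩ := natDegree_para hq hql d
    refine ⟨X * q + C d * starPoly l q, hm', hd',
      fun z hz => eval_para_of_norm_lt_one hql.le hd1 hz (hqz z hz).1 (hqz z hz).2, ?_⟩
    have hη : C ((starRingEnd ℂ) (T.coeff 0)) * C (T.coeff 0) = (1 : ℂ[X]) := by
      rw [← C_mul, conj_mul_self_of_norm_eq_one h0, C_1]
    rw [starPoly_para hΦ.2.1.le] at hqT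
    rw [starPoly_para hql.le, hdc, map_mul, map_mul, Complex.conj_conj, C_mul]
    conv_lhs => rw [hqT]
    linear_combination -(C c * X * q * starPoly k Φ) * hη

end representation

/-! ### Discrete measures -/

noncomputable section

/-- The measure with masses `w s` at the points `φ s`. -/
def discreteMeasure {n : ℕ} (w φ : Fin n → ℝ) : Measure ℝ :=
  ∑ s, ENNReal.ofReal (w s) • Measure.dirac (φ s)

end

section discrete

variable {n : ℕ} {w φ : Fin n → ℝ}

instance isFiniteMeasure_discreteMeasure : IsFiniteMeasure (discreteMeasure w φ) := by
  refine ⟨?_⟩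
  simp [discreteMeasure, ENNReal.sum_lt_top]

theorem szegoForm_discreteMeasure (hw : ∀ s, 0 < w s) (p q : ℂ[X]) :
    szegoForm (discreteMeasure w φ) p q =
      ∑ s, (w s : ℂ) * ((starRingEnd ℂ) (q.eval (cis (φ s))) * p.eval (cis (φ s))) := by
  rw [szegoForm, discreteMeasure, integral_finsetSum_measure]
  · refine Finset.sum_congr rfl fun s _ => ?_
    rw [integral_smul_measure, integral_dirac, ENNReal.toReal_ofReal (hw s).le, Complex.real_smul]
  · exact fun s _ => (integrable_szegoForm p q).smul_measure ENNReal.ofReal_ne_top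

theorem eq_zero_of_szegoForm_discreteMeasure_self (hw : ∀ s, 0 < w s)
    (hφ : Function.Injective fun s => cis (φ s)) {p : ℂ[X]} (hp : p.degree < n)
    (h : szegoForm (discreteMeasure w φ) p p = 0) : p = 0 := by
  have h1 : ∑ s, w s * ‖p.eval (cis (φ s))‖ ^ 2 = 0 := by
    rw [szegoForm_discreteMeasure hw] at h
    simp only [Complex.conj_mul'] at h
    exact_mod_cast h
  rw [Finset.sum_eq_zero_iff_of_nonneg fun s _ => mul_nonneg (hw s).le (by positivity)] at h1
  refine eq_zero_of_degree_lt_of_eval_index_eq_zero Finset.univ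
    (v := fun s => cis (φ s)) hφ.injOn (by simpa using hp) fun s hs => ?_
  simpa [(hw s).ne'] using h1 s hs

theorem szegoForm_nodePoly (hw : ∀ s, 0 < w s) (p : ℂ[X]) :
    szegoForm (discreteMeasure w φ) (nodePoly φ) p = 0 := by
  rw [szegoForm_discreteMeasure hw]
  refine Finset.sum_eq_zero fun s _ => ?_
  rw [(isRoot_nodePoly.2 ⟨s, rfl⟩ : (nodePoly φ).IsRoot _).eq_zero, mul_zero, mul_zero]

theorem norm_coeff_zero_nodePoly : ‖(nodePoly φ).coeff 0‖ = 1 := by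
  rw [coeff_zero_eq_eval_zero, nodePoly, eval_prod, norm_prod]
  simp [norm_cis]

end discrete

/-! ### Moments and quadrature formulas -/

section moments

variable {ρ ρ' : Measure ℝ}

theorem szegoForm_sum_left {ι : Type*} [IsFiniteMeasure ρ] (s : Finset ι) (f : ι → ℂ[X])
    (q : ℂ[X]) : szegoForm ρ (∑ i ∈ s, f i) q = ∑ i ∈ s, szegoForm ρ (f i) q := by
  classical
  induction s using Finset.induction_on with
  | empty => simp [szegoForm_zero_left]
  | insert a s ha ih => rw [Finset.sum_insert ha, Finset.sum_insert ha, szegoForm_add_left, ih]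

theorem szegoForm_X_pow_X_pow_add (i j : ℕ) :
    szegoForm ρ (X ^ (j + i)) (X ^ j) = szegoForm ρ (X ^ i) 1 := by
  induction j with
  | zero => simp
  | succ j ih => rw [← ih, ← szegoForm_X_mul (X ^ (j + i)), ← pow_succ', ← pow_succ', add_right_comm]

theorem szegoForm_X_pow_eq_of_moments {d : ℕ}
    (h : ∀ j ≤ d, szegoForm ρ (X ^ j) 1 = szegoForm ρ' (X ^ j) 1) {i j : ℕ} (hi : i ≤ d)
    (hj : j ≤ d) : szegoForm ρ (X ^ i) (X ^ j) = szegoForm ρ' (X ^ i) (X ^ j) := by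
  rcases le_total j i with hij | hij
  · obtain ⟨m, rfl⟩ := Nat.exists_eq_add_of_le hij
    rw [szegoForm_X_pow_X_pow_add, szegoForm_X_pow_X_pow_add, h m (by omega)]
  · obtain ⟨m, rfl⟩ := Nat.exists_eq_add_of_le hij
    rw [← szegoForm_conj, szegoForm_X_pow_X_pow_add, ← szegoForm_conj (ρ := ρ') (X ^ (i + m)),
      szegoForm_X_pow_X_pow_add, h m (by omega)]

/-- On the circle `⟨z^i, z^j⟩` depends only on `i - j`, so the orthogonality relations of degree `k`
are determined by the moments of order at most `k`. -/
theorem IsMonicOrthogonal.of_moments [IsFiniteMeasure ρ] [IsFiniteMeasure ρ'] {k : ℕ} {Φ : ℂ[X]}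
    (hΦ : IsMonicOrthogonal ρ k Φ)
    (h : ∀ j ≤ k, szegoForm ρ (X ^ j) 1 = szegoForm ρ' (X ^ j) 1) :
    IsMonicOrthogonal ρ' k Φ := by
  refine isMonicOrthogonal_of_szegoForm hΦ.1 hΦ.2.1 fun j hj => ?_
  rw [← hΦ.szegoForm_eq_zero (q := X ^ j) (by rw [degree_X_pow]; exact_mod_cast hj),
    Φ.as_sum_support_C_mul_X_pow, szegoForm_sum_left, szegoForm_sum_left]
  refine Finset.sum_congr rfl fun i hi => ?_
  rw [szegoForm_C_mul_left, szegoForm_C_mul_left, szegoForm_X_pow_eq_of_moments h _ hj.le]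
  exact (le_natDegree_of_mem_supp i hi).trans hΦ.2.1.le

theorem isTrigPoly_cos {d j : ℕ} (hj : j ≤ d) : IsTrigPoly d fun θ => Real.cos (j * θ) :=
  ⟨Pi.single j 1, 0, fun θ => by
    simp [Pi.single_apply, Finset.sum_ite_eq', Nat.lt_succ_of_le hj]⟩

theorem isTrigPoly_sin {d j : ℕ} (hj : j ≤ d) : IsTrigPoly d fun θ => Real.sin (j * θ) :=
  ⟨0, Pi.single j 1, fun θ => by
    simp [Pi.single_apply, Finset.sum_ite_eq', Nat.lt_succ_of_le hj]⟩

theorem cis_pow_eq_cos_add_sin (j : ℕ) (θ : ℝ) :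
    cis θ ^ j = (Real.cos (j * θ) : ℂ) + (Real.sin (j * θ) : ℂ) * Complex.I := by
  rw [← cis_natCast_mul, cis, Complex.exp_mul_I, Complex.ofReal_cos, Complex.ofReal_sin]

theorem szegoForm_X_pow_one (j : ℕ) [IsFiniteMeasure ρ] : szegoForm ρ (X ^ j) 1 =
    ((∫ θ, Real.cos (j * θ) ∂ρ : ℝ) : ℂ) + ((∫ θ, Real.sin (j * θ) ∂ρ : ℝ) : ℂ) * Complex.I := by
  have hc : Integrable (fun θ : ℝ => Real.cos (j * θ)) ρ :=
    Integrable.of_bound (by fun_prop) 1 (Filter.Eventually.of_forall fun θ => Real.abs_cos_le_one _)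
  have hs : Integrable (fun θ : ℝ => Real.sin (j * θ)) ρ :=
    Integrable.of_bound (by fun_prop) 1 (Filter.Eventually.of_forall fun θ => Real.abs_sin_le_one _)
  rw [← integral_complex_ofReal, ← integral_complex_ofReal, ← integral_mul_const,
    ← integral_add hc.ofReal (hs.ofReal.mul_const _), szegoForm]
  simp only [eval_one, map_one, one_mul, eval_pow, eval_X, cis_pow_eq_cos_add_sin]

/-- A positive quadrature formula is a discrete measure with the same moments. -/
theorem GeneratesPositiveQF.exists_moments {σ : Measure ℝ} [IsFiniteMeasure σ] {d n : ℕ}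
    {φ : Fin n → ℝ} (h : GeneratesPositiveQF σ d φ) :
    ∃ w : Fin n → ℝ, (∀ s, 0 < w s) ∧
      ∀ j ≤ d, szegoForm σ (X ^ j) 1 = szegoForm (discreteMeasure w φ) (X ^ j) 1 := by
  obtain ⟨-, μ, hμ, hq⟩ := h
  -- The factor `2π` absorbs the normalisation `1/(2π)` of the quadrature formula.
  have hw : ∀ s, 0 < 2 * Real.pi * μ s := fun s => mul_pos Real.two_pi_pos (hμ s)
  have hq' : ∀ t, IsTrigPoly d t → ∫ θ, t θ ∂σ = ∑ s, 2 * Real.pi * μ s * t (φ s) := by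
    intro t ht
    have := hq t ht
    simp only [mul_assoc (2 * Real.pi), ← Finset.mul_sum, ← this]
    field_simp
  refine ⟨fun s => 2 * Real.pi * μ s, hw, fun j hj => ?_⟩
  rw [szegoForm_X_pow_one, hq' _ (isTrigPoly_cos hj), hq' _ (isTrigPoly_sin hj),
    szegoForm_discreteMeasure hw]
  simp only [eval_one, map_one, one_mul, eval_pow, eval_X, cis_pow_eq_cos_add_sin]
  push_cast
  rw [Finset.sum_mul, ← Finset.sum_add_distrib]
  exact Finset.sum_congr rfl fun s _ => by ring

end moments

/-! ### Separation of zeros and nodes -/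

section separation

theorem cis_add (x y : ℝ) : cis (x + y) = cis x * cis y := by
  simp only [cis, ← Complex.exp_add]
  push_cast
  ring_nf

theorem cis_sub_cis (x y : ℝ) :
    cis x - cis y = 2 * Complex.I * cis ((x + y) / 2) * Real.sin ((x - y) / 2) := by
  have hs : (Real.sin ((x - y) / 2) : ℂ) =
      (cis (-((x - y) / 2)) - cis ((x - y) / 2)) * Complex.I / 2 := by
    rw [Complex.ofReal_sin, Complex.sin, cis, cis]
    push_cast
    ring
  have h1 : cis x = cis ((x + y) / 2) * cis ((x - y) / 2) := by
    rw [← cis_add]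
    ring_nf
  have h2 : cis y = cis ((x + y) / 2) * cis (-((x - y) / 2)) := by
    rw [← cis_add]
    ring_nf
  rw [hs, h1, h2]
  linear_combination (cis ((x + y) / 2) * (cis ((x - y) / 2) - cis (-((x - y) / 2)))) *
    Complex.I_sq

/-- Up to a constant independent of `θ`, the quantity `z̄(z - a)(z - b)` is real on the circle, with
a sign read off from the two sines. -/
theorem conj_cis_mul_sub_mul_sub (θ α β : ℝ) :
    (starRingEnd ℂ) (cis θ) * ((cis θ - cis α) * (cis θ - cis β)) =
      -4 * cis ((α + β) / 2) *
        ((Real.sin ((θ - α) / 2) * Real.sin ((θ - β) / 2) : ℝ) : ℂ) := by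
  have h : cis ((α + β) / 2) = cis (-θ) * (cis ((θ + α) / 2) * cis ((θ + β) / 2)) := by
    rw [← cis_add, ← cis_add]
    ring_nf
  rw [cis_sub_cis, cis_sub_cis, conj_cis, h]
  push_cast
  linear_combination 4 * cis (-θ) * cis ((θ + α) / 2) * cis ((θ + β) / 2) *
    Complex.sin ((θ - α) / 2) * Complex.sin ((θ - β) / 2) * Complex.I_sq

/-- If no node of a discrete measure lies in the open arc between two consecutive zeros of `P`,
and `P` is orthogonal to `z, …, z^k`, then all nodes are zeros of `P`. -/
theorem isRoot_of_not_mem_arc {n k : ℕ} {w φ : Fin n → ℝ} (hw : ∀ s, 0 < w s) {P : ℂ[X]}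
    (hP : P.Monic) (hd : P.natDegree = k + 1)
    (horth : ∀ r : ℂ[X], r.degree < k → szegoForm (discreteMeasure w φ) P (X * r) = 0)
    {α β : ℝ} (harc : IsZeroArc P α β)
    (hnode : ∀ s, ∀ m : ℤ, φ s + 2 * Real.pi * m ∉ Ioo α β) (s : Fin n) :
    P.IsRoot (cis (φ s)) := by
  obtain ⟨hαβ, hα, hβ, hno⟩ := harc
  -- Node angles are lifted to `[α, α + 2π)`; absence from the arc leaves only `α` or `[β, α + 2π)`.
  choose θ hθ hcis using fun s => exists_cis_eq (norm_cis (φ s)) α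
  have hθn : ∀ s, θ s = α ∨ β ≤ θ s := by
    intro s
    obtain ⟨m, hm⟩ := cis_eq_cis_iff.1 (hcis s)
    have h1 := hnode s m
    rw [← hm, mem_Ioo, not_and_or, not_lt, not_lt] at h1
    exact h1.imp_left fun h => le_antisymm h (hθ s).1
  have hβ' : β ≤ α + 2 * Real.pi := by
    by_contra! hc
    refine hno (α + 2 * Real.pi) ⟨by linarith [Real.pi_pos], hc⟩ ?_
    have := cis_add_two_pi_mul_int α 1
    rw [Int.cast_one, mul_one] at this
    rwa [this]
  -- If `β = α + 2π`, the arc is the circle minus one point and every node sits at that zero.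
  rcases hβ'.eq_or_lt with hβe | hβl
  · rw [← hcis s, (hθn s).resolve_right fun h => by linarith [(hθ s).2]]
    exact hα
  have hne : cis β ≠ cis α := by
    intro he
    obtain ⟨m, hm⟩ := cis_eq_cis_iff.1 he
    have hp := Real.two_pi_pos
    have h1 : (m : ℝ) < 1 := by
      by_contra! hc
      nlinarith
    have h2 : (0 : ℝ) < m := by
      by_contra! hc
      nlinarith
    have h3 : m < 1 := by exact_mod_cast h1
    have h4 : 0 < m := by exact_mod_cast h2
    omega
  obtain ⟨R, hR⟩ : (X - C (cis β)) * (X - C (cis α)) ∣ P :=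
    (pairwise_coprime_X_sub_C (s := id) Function.injective_id hne).mul_dvd
      (dvd_iff_isRoot.2 hβ) (dvd_iff_isRoot.2 hα)
  have hR0 : R ≠ 0 := by
    rintro rfl
    rw [mul_zero] at hR
    exact hP.ne_zero hR
  have hRd : R.degree < k := by
    have := congrArg natDegree hR
    rw [hd, ((monic_X_sub_C _).mul (monic_X_sub_C _)).natDegree_mul' hR0,
      (monic_X_sub_C _).natDegree_mul (monic_X_sub_C _), natDegree_X_sub_C,
      natDegree_X_sub_C] at this
    rw [degree_eq_natDegree hR0]
    exact_mod_cast (by omega : R.natDegree < k)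
  -- Up to the constant, this is the integrand of `⟨P, zR⟩` at the nodes. Both half-angles lie in
  -- `[0, π]` when `θ s ≥ β`, so it is nonnegative.
  set x : Fin n → ℝ := fun s =>
    Real.sin ((θ s - α) / 2) * Real.sin ((θ s - β) / 2) * ‖R.eval (cis (θ s))‖ ^ 2 with hx
  have hx0 : ∀ s, 0 ≤ x s := by
    intro s
    refine mul_nonneg ?_ (by positivity)
    rcases hθn s with h | h
    · simp [h]
    · have h1 := (hθ s).2
      exact mul_nonneg
        (Real.sin_nonneg_of_nonneg_of_le_pi (by linarith) (by linarith))
        (Real.sin_nonneg_of_nonneg_of_le_pi (by linarith) (by linarith))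
  have hterm : ∀ s, (starRingEnd ℂ) ((X * R).eval (cis (φ s))) * P.eval (cis (φ s)) =
      -4 * cis ((α + β) / 2) * (x s : ℂ) := by
    intro s
    rw [← hcis s, hR, hx]
    simp only [eval_mul, eval_X, eval_sub, eval_C, map_mul]
    have h1 := conj_cis_mul_sub_mul_sub (θ s) α β
    have h2 := Complex.conj_mul' (R.eval (cis (θ s)))
    push_cast at h1 ⊢
    rw [← h2]
    linear_combination (starRingEnd ℂ) (R.eval (cis (θ s))) * R.eval (cis (θ s)) * h1
  have hsum : ∑ s, w s * x s = 0 := by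
    have h1 := horth R hRd
    rw [szegoForm_discreteMeasure hw] at h1
    simp only [hterm, mul_left_comm (w _ : ℂ)] at h1
    rw [← Finset.mul_sum] at h1
    exact_mod_cast (mul_eq_zero.1 h1).resolve_left (mul_ne_zero (by norm_num) (cis_ne_zero _))
  rw [Finset.sum_eq_zero_iff_of_nonneg fun s _ => mul_nonneg (hw s).le (hx0 s)] at hsum
  have hxs : x s = 0 := (mul_eq_zero.1 (hsum s (Finset.mem_univ s))).resolve_left (hw s).ne'
  have h1 := hterm s
  rw [hxs, Complex.ofReal_zero, mul_zero] at h1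
  rcases mul_eq_zero.1 h1 with h2 | h2
  · rw [map_eq_zero, eval_mul, eval_X] at h2
    rw [IsRoot.def, hR, eval_mul, (mul_eq_zero.1 h2).resolve_left (cis_ne_zero _), mul_zero]
  · exact h2

/-- Without a node in the arc all `n` distinct nodes are zeros of a monic polynomial of degree `k +
1 ≤ n`, which must then be the node polynomial. -/
theorem IsMonicOrthogonal.exists_node_mem_arc {n k : ℕ} {w φ : Fin n → ℝ} (hw : ∀ s, 0 < w s)
    (hφ : IsAngleList φ) {Φ : ℂ[X]} (hΦ : IsMonicOrthogonal (discreteMeasure w φ) k Φ)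
    (hk : k + 1 ≤ n) {κ : ℂ} (hne : nodePoly φ ≠ X * Φ + C κ * starPoly k Φ) {α β : ℝ}
    (harc : IsZeroArc (X * Φ + C κ * starPoly k Φ) α β) :
    ∃ s, ∃ m : ℤ, φ s + 2 * Real.pi * m ∈ Ioo α β := by
  by_contra! hc
  obtain ⟨hm, hd⟩ := natDegree_para hΦ.1 hΦ.2.1 κ
  have hroot := isRoot_of_not_mem_arc hw hm hd (fun r hr => hΦ.szegoForm_para κ hr) harc hc
  refine hne (eq_of_monic_of_dvd_of_natDegree_le (monic_nodePoly φ) hm ?_ ?_).symm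
  · exact Finset.prod_dvd_of_coprime
      (fun s _ t _ hst => pairwise_coprime_X_sub_C hφ.injective_cis hst)
      fun s _ => dvd_iff_isRoot.2 (hroot s)
  · rw [hd, natDegree_nodePoly]
    exact hk

/-- The zeros of a para-orthogonal polynomial are the nodes of a Gauss–Szegő quadrature formula. -/
theorem IsMonicOrthogonal.exists_weights {ρ : Measure ℝ} [IsFiniteMeasure ρ] {n k : ℕ} {Φ : ℂ[X]}
    (hΦ : IsMonicOrthogonal ρ k Φ) (hdef : ∀ p : ℂ[X], szegoForm ρ p p = 0 → p = 0) {κ : ℂ}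
    (hk : k + 1 = n) {φ : Fin n → ℝ} (hφ : IsAngleList φ)
    (hQ : X * Φ + C κ * starPoly k Φ = nodePoly φ) :
    ∃ w : Fin n → ℝ, (∀ s, 0 < w s) ∧
      ∀ j ≤ k, szegoForm ρ (X ^ j) 1 = szegoForm (discreteMeasure w φ) (X ^ j) 1 := by
  classical
  set v : Fin n → ℂ := fun s => cis (φ s) with hv
  have hinj : InjOn v (Finset.univ : Finset (Fin n)) := hφ.injective_cis.injOn
  set b := Lagrange.basis Finset.univ v with hb
  have hb0 : ∀ s, b s ≠ 0 := fun s => Lagrange.basis_ne_zero hinj (Finset.mem_univ s)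
  have hbd : ∀ s, (b s).natDegree = k := fun s => by
    rw [hb, Lagrange.natDegree_basis hinj (Finset.mem_univ s), Finset.card_univ, Fintype.card_fin,
      ← hk, Nat.add_sub_cancel]
  have hbQ : ∀ s, ∃ c : ℂ, (X - C (v s)) * b s = C c * nodePoly φ := fun s => by
    refine ⟨∏ t ∈ Finset.univ.erase s, (v s - v t)⁻¹, ?_⟩
    rw [hb, Lagrange.basis]
    simp only [Lagrange.basisDivisor]
    rw [Finset.prod_mul_distrib, ← map_prod, mul_left_comm, nodePoly,
      ← Finset.mul_prod_erase _ _ (Finset.mem_univ s)]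
  -- The polynomial `1 - b_s` vanishes at the node `v_s`. Moving its factor `z - v_s` over to `b_s`
  -- gives a multiple of the para-orthogonal polynomial, paired with `zM`, `deg M < k`. Hence the
  -- interpolatory weight `∫ b_s` equals `‖b_s‖² > 0`.
  have horth : ∀ s, szegoForm ρ (b s) (1 - b s) = 0 := by
    intro s
    obtain ⟨M, hM⟩ : X - C (v s) ∣ 1 - b s := by
      rw [dvd_iff_isRoot, IsRoot.def, eval_sub, eval_one, hb,
        Lagrange.eval_basis_self hinj (Finset.mem_univ s), sub_self]
    obtain ⟨c, hc⟩ := hbQ s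
    rw [hM, szegoForm_X_sub_C_mul_right (conj_mul_self_of_norm_eq_one (norm_cis (φ s))), hc, ← hQ,
      szegoForm_C_mul_left, hΦ.szegoForm_para, mul_zero, mul_zero]
    by_cases hM0 : M = 0
    · rw [hM0, degree_zero]
      exact WithBot.bot_lt_coe k
    · have h1 := natDegree_sub_le 1 (b s)
      rw [hM, (monic_X_sub_C _).natDegree_mul' hM0, natDegree_X_sub_C, natDegree_one, hbd] at h1
      rw [degree_eq_natDegree hM0]
      exact_mod_cast (by omega : M.natDegree < k)
  have hw : ∀ s, 0 < (szegoForm ρ (b s) (b s)).re := fun s =>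
    (szegoForm_self_re_nonneg _).lt_of_ne fun h => hb0 s (hdef _ (by
      rw [szegoForm_self_eq_re, ← h, Complex.ofReal_zero]))
  refine ⟨fun s => (szegoForm ρ (b s) (b s)).re, hw, fun j hj => ?_⟩
  have hint : (X : ℂ[X]) ^ j = ∑ s, C (v s ^ j) * b s := by
    have h1 := Lagrange.eq_interpolate (f := (X : ℂ[X]) ^ j) hinj (by
      rw [degree_X_pow, Finset.card_univ, Fintype.card_fin]
      exact_mod_cast (by omega : j < n))
    simpa [Lagrange.interpolate_apply] using h1
  rw [szegoForm_discreteMeasure hw, hint, szegoForm_sum_left, ← hint]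
  refine Finset.sum_congr rfl fun s _ => ?_
  have h1 := horth s
  rw [szegoForm_sub_right, sub_eq_zero] at h1
  rw [szegoForm_C_mul_left, h1, ← szegoForm_self_eq_re, eval_one, map_one, one_mul, eval_pow, eval_X,
    mul_comm]

/-- Eliminating `Φ` gives `qP - T = (κq - ηq^*)Φ^*`, and `Φ^*` has no zero on the circle where `Φ`
has none. -/
theorem isRoot_of_common_root {k l : ℕ} {Φ q : ℂ[X]} {κ η z : ℂ} (hd : Φ.natDegree ≤ k)
    (hz : ‖z‖ = 1) (hΦ : ¬ Φ.IsRoot z)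
    (hT : (X * q * Φ + C η * starPoly l q * starPoly k Φ).IsRoot z)
    (hP : (X * Φ + C κ * starPoly k Φ).IsRoot z) :
    (C κ * q - C η * starPoly l q).IsRoot z := by
  have hstar : (starPoly k Φ).eval z ≠ 0 := by
    obtain ⟨θ, -, rfl⟩ := exists_cis_eq hz 0
    rw [eval_cis_starPoly hd]
    exact mul_ne_zero (pow_ne_zero _ (cis_ne_zero θ)) ((_root_.map_ne_zero _).2 hΦ)
  simp only [IsRoot.def, eval_add, eval_sub, eval_mul, eval_X, eval_C] at hT hP ⊢
  refine (mul_eq_zero.1 ?_).resolve_right hstar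
  linear_combination q.eval z * hP - hT

end separation

/-! ### The main theorem -/

theorem mainTheorem5 (σ : Measure ℝ) (hσ : IsSzegoMeasure σ) (n l : ℕ) (hl : l < n)
    (κ : ℂ) (hκ : ‖κ‖ = 1) :
    (∃ ψ : Fin (n - l) → ℝ, IsAngleList ψ ∧ paraOrthogonal σ (n - 1 - l) κ = nodePoly ψ) ∧
    (∀ m ≤ l, ∀ φ : Fin n → ℝ, GeneratesPositiveQF σ (n - 1 - m) φ →
      (nodePoly φ ≠ paraOrthogonal σ (n - 1 - l) κ →
        ∀ α β : ℝ, IsZeroArc (paraOrthogonal σ (n - 1 - l) κ) α β →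
          ∃ s, ∃ k : ℤ, φ s + 2 * Real.pi * k ∈ Ioo α β) ∧
      (∃ q η, IsRepresentation σ (n - 1 - l) l (nodePoly φ) q η) ∧
      (∀ q η, IsRepresentation σ (n - 1 - l) l (nodePoly φ) q η →
        ∀ z, (nodePoly φ).IsRoot z → (paraOrthogonal σ (n - 1 - l) κ).IsRoot z →
          (C κ * q - C η * starPoly l q).IsRoot z)) ∧
    (∀ η : ℂ, ‖η‖ = 1 → paraOrthogonal σ (n - 1) η ≠ paraOrthogonal σ (n - 1 - l) κ →
      ∀ α β : ℝ, IsZeroArc (paraOrthogonal σ (n - 1 - l) κ) α β →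
        ∃ θ ∈ Ioo α β, (paraOrthogonal σ (n - 1) η).IsRoot (cis θ)) := by
  have hfin := hσ.isFiniteMeasure
  have hdef : ∀ p : ℂ[X], szegoForm σ p p = 0 → p = 0 := fun p => hσ.eq_zero_of_szegoForm_self
  have hΦ := monicOP_spec hσ (n - 1 - l)
  refine ⟨hΦ.para_zeros hdef hκ (by omega), fun m hm φ hφ => ?_, fun η hη hne α β harc => ?_⟩
  · obtain ⟨w, hw, hmom⟩ := hφ.exists_moments
    -- Here `m ≤ l` enters: exactness reaches degree `n - 1 - m ≥ n - 1 - l`.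
    have hΦ' := hΦ.of_moments fun j hj => hmom j (by omega)
    refine ⟨fun hne α β harc => hΦ'.exists_node_mem_arc hw hφ.1 (by omega) hne harc, ?_, ?_⟩
    · obtain ⟨q, hq, hql, hqz, hqT⟩ := IsMonicOrthogonal.exists_representation (monic_nodePoly φ)
        (natDegree_nodePoly φ) norm_coeff_zero_nodePoly (szegoForm_nodePoly hw)
        (fun p => eq_zero_of_szegoForm_discreteMeasure_self hw hφ.1.injective_cis) l _ _ hΦ'
        (by omega)
      exact ⟨q, _, hq, hql, fun z hz => not_le.1 fun h => (hqz z h).1 hz,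
        norm_coeff_zero_nodePoly, hqT⟩
    · rintro q η ⟨-, -, -, -, hT⟩ z hz hPz
      have hz1 : ‖z‖ = 1 := by
        obtain ⟨s, rfl⟩ := isRoot_nodePoly.1 hz
        exact norm_cis _
      rw [hT] at hz
      exact isRoot_of_common_root hΦ.2.1.le hz1 (hΦ.not_isRoot hdef hz1) hz hPz
  -- The zeros of `zΦ_{n-1} + ηΦ_{n-1}^*` serve as nodes of a discrete measure matching the moments
  -- up to order `n - 1`, to which separation applies.
  · have hΨ := monicOP_spec hσ (n - 1)
    obtain ⟨φ, hφ, hQ⟩ := hΨ.para_zeros hdef hη (by omega : n - 1 + 1 = n)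
    obtain ⟨w, hw, hmom⟩ := hΨ.exists_weights hdef (by omega) hφ hQ
    have hΦ' := hΦ.of_moments fun j hj => hmom j (by omega)
    have hQ' : paraOrthogonal σ (n - 1) η = nodePoly φ := hQ
    rw [hQ'] at hne ⊢
    obtain ⟨s, m, hs⟩ := hΦ'.exists_node_mem_arc hw hφ (by omega) hne harc
    exact ⟨_, hs, isRoot_nodePoly.2 ⟨s, cis_add_two_pi_mul_int _ _⟩⟩
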